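/- Let $E$ be a real Banach space that is uniformly convex, smooth (i.e. $\lim_{t\to0}(\|x+ty\|-\|x\|)/t$ exists for all unit vectors $x,y$) and satisfies Opial's condition: whenever $u_n\rightharpoonup a$ weakly and $b\neq a$, then $\limsup_n\|u_n-a\|<\limsup_n\|u_n-b\|$. Let $K$ be a nonempty closed convex subset of $E$ and let $P:E\to K$ be a sunny nonexpansive retraction, i.e. $Px=x$ for $x\in K$, $\|Px-Py\|\le\|x-y\|$ for $x,y\in E$, and $P(Px+t(x-Px))=Px$ for all $x\in E$, $t\ge0$. Let $T_1,T_2:K\to E$ be maps such that, for $i=1,2$: (a) $T_i$ is weakly inward: for every $x\in K$, $T_ix$ lies in the closure of $\{x+c(u-x):u\in K,\ c\ge1\}$; (b) $T_i$ is uniformly $L$-Lipschitzian with respect to $P$ for some constant $L\ge0$: $\|(PT_i)^nx-(PT_i)^ny\|\le L\|x-y\|$ for all $x,y\in K$, $n\ge1$ (this holds in particular if $\|T_i(PT_i)^{n-1}x-T_i(PT_i)^{n-1}y\|\le L\|x-y\|$ for all $x,y\in K$, $n\ge1$); (c) $T_i$ is total asymptotically nonexpansive: $\|(PT_i)^nx-(PT_i)^ny\|\le\|x-y\|+\mu_n\phi(\|x-y\|)+\lambda_n$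 for all $x,y\in K$, $n\ge1$, where $\mu_n,\lambda_n\ge0$ tend to $0$ and $\phi:\mathbb R\to\mathbb R$ is a strictly increasing continuous function with $\phi(0)=0$; (d) $I-T_i$ is demiclosed at zero: if $u_n\in K$, $u_n\rightharpoonup a\in K$ weakly and $u_n-T_iu_n\to0$ in norm, then $T_ia=a$. Suppose that $\sum_{n\ge1}\mu_n<\infty$ and $\sum_{n\ge1}\lambda_n<\infty$, that there are $M,M^*>0$ with $\phi(\kappa)\le M^*\kappa$ for all $\kappa\ge M$, that $T_1$ and $T_2$ have a common fixed point, and that $\alpha_n,\beta_n\in[\varepsilon,1-\varepsilon]$ for all $n\ge1$, for some $\varepsilon\in(0,1)$. Let $x_1\in K$ be arbitrary and, for $n\ge1$, $$y_n=(1-\beta_n)x_n+\beta_n(PT_1)^nx_n,\qquad x_{n+1}=(1-\alpha_n)(PT_1)^ny_n+\alpha_n(PT_2)^ny_n.$$ Then $\{x_n\}$ converges weakly to a common fixed point of $T_1$ and $T_2$. -/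

import Mathlib

open Filter Topology

/-- Weak convergence of a sequence: convergence in the weak topology `σ(E, E*)`. -/
def WeaklyConverges {E : Type*} [NormedAddCommGroup E] [NormedSpace ℝ E]
    (u : ℕ → E) (a : E) : Prop :=
  Tendsto (fun n => toWeakSpace ℝ E (u n)) atTop (𝓝 (toWeakSpace ℝ E a))

/-- Smoothness: the norm is Gateaux differentiable on the unit sphere. -/
def IsSmoothSpace (E : Type*) [NormedAddCommGroup E] [NormedSpace ℝ E] : Prop :=
  ∀ x y : E, ‖x‖ = 1 → ‖y‖ = 1 →
    ∃ l : ℝ, Tendsto (fun t : ℝ => (‖x + t • y‖ - ‖x‖) / t) (𝓝[≠] 0) (𝓝 l)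

/-- Opial's condition. In a Banach space a weakly convergent sequence is bounded, so that both
upper limits are genuine real numbers. -/
def OpialCondition (E : Type*) [NormedAddCommGroup E] [NormedSpace ℝ E] : Prop :=
  ∀ (u : ℕ → E) (a b : E), WeaklyConverges u a → b ≠ a →
    limsup (fun n => ‖u n - a‖) atTop < limsup (fun n => ‖u n - b‖) atTop

/-- `P` is a sunny nonexpansive retraction of `E` onto `K`. -/
structure IsSunnyNonexpansiveRetraction {E : Type*} [NormedAddCommGroup E] [NormedSpace ℝ E]
    {K : Set E} (P : E → K) : Prop where
  retraction : ∀ x : K, P (x : E) = x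
  nonexpansive : ∀ x y : E, ‖(P x : E) - (P y : E)‖ ≤ ‖x - y‖
  sunny : ∀ (x : E) (t : ℝ), 0 ≤ t → P ((P x : E) + t • (x - (P x : E))) = P x

/-- The inward set `{x + c (u - x) : u ∈ K, c ≥ 1}` of `x` with respect to `K`. -/
def inwardSet {E : Type*} [NormedAddCommGroup E] [NormedSpace ℝ E] (K : Set E) (x : E) : Set E :=
  {z | ∃ u ∈ K, ∃ c : ℝ, 1 ≤ c ∧ z = x + c • (u - x)}

/-- `T : K → E` is weakly inward. -/
def IsWeaklyInward {E : Type*} [NormedAddCommGroup E] [NormedSpace ℝ E] {K : Set E}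
    (T : K → E) : Prop :=
  ∀ x : K, T x ∈ closure (inwardSet K (x : E))

/-- The nonself map `T : K → E` is total asymptotically nonexpansive (with respect to `P`), with
sequences `(μ n)`, `(lam n)`, `n ≥ 1`, and gauge function `φ`. -/
structure IsTotalAsymptoticallyNonexpansive {E : Type*} [NormedAddCommGroup E] [NormedSpace ℝ E]
    {K : Set E} (P : E → K) (T : K → E) (μ lam : ℕ → ℝ) (φ : ℝ → ℝ) : Prop where
  mu_nonneg : ∀ n, 1 ≤ n → 0 ≤ μ n
  lam_nonneg : ∀ n, 1 ≤ n → 0 ≤ lam n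
  mu_tendsto : Tendsto μ atTop (𝓝 0)
  lam_tendsto : Tendsto lam atTop (𝓝 0)
  phi_strictMono : StrictMono φ
  phi_continuous : Continuous φ
  phi_zero : φ 0 = 0
  bound : ∀ n, 1 ≤ n → ∀ x y : K,
    ‖(((P ∘ T)^[n] x : K) : E) - (((P ∘ T)^[n] y : K) : E)‖
      ≤ ‖(x : E) - (y : E)‖ + μ n * φ ‖(x : E) - (y : E)‖ + lam n

/-- The nonself map `T : K → E` is uniformly `L`-Lipschitzian (with respect to `P`). As `P` is
nonexpansive, this follows from `‖T (PT)ⁿ⁻¹ x - T (PT)ⁿ⁻¹ y‖ ≤ L ‖x - y‖` for all `n ≥ 1`. -/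
def IsUniformlyLipschitzian {E : Type*} [NormedAddCommGroup E] [NormedSpace ℝ E]
    {K : Set E} (P : E → K) (T : K → E) (L : ℝ) : Prop :=
  ∀ n, 1 ≤ n → ∀ x y : K,
    ‖(((P ∘ T)^[n] x : K) : E) - (((P ∘ T)^[n] y : K) : E)‖ ≤ L * ‖(x : E) - (y : E)‖

/-- The map `A`, with domain `K`, is demiclosed at `p`. -/
def IsDemiclosedAt {E : Type*} [NormedAddCommGroup E] [NormedSpace ℝ E] {K : Set E}
    (A : K → E) (p : E) : Prop :=
  ∀ (u : ℕ → K) (a : K), WeaklyConverges (fun n => (u n : E)) (a : E) →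
    Tendsto (fun n => A (u n)) atTop (𝓝 p) → A a = p

/-- `x 1, x 2, …` is generated by the two-step scheme
`y n = (1 - β n) x n + β n (P T₁)ⁿ (x n)`,
`x (n + 1) = (1 - α n) (P T₁)ⁿ (y n) + α n (P T₂)ⁿ (y n)`, `n ≥ 1`,
from an arbitrary `x 1 ∈ K`. The values at index `0` play no role. -/
structure IsTwoStepIteration {E : Type*} [NormedAddCommGroup E] [NormedSpace ℝ E]
    {K : Set E} (P : E → K) (T₁ T₂ : K → E) (α β : ℕ → ℝ) (x y : ℕ → K) : Prop where
  y_eq : ∀ n, 1 ≤ n →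
    (y n : E) = (1 - β n) • (x n : E) + β n • (((P ∘ T₁)^[n] (x n) : K) : E)
  x_succ : ∀ n, 1 ≤ n →
    (x (n + 1) : E) = (1 - α n) • (((P ∘ T₁)^[n] (y n) : K) : E)
      + α n • (((P ∘ T₂)^[n] (y n) : K) : E)

/-!
Write `S = P ∘ T₁` and `Q = P ∘ T₂`. The proof works with these self maps of `K` throughout and
returns to `T₁`, `T₂` only at the end, since a weakly inward `T` and `P ∘ T` have the same fixed
points (`IsWeaklyInward.fixed_of_retraction_fixed`, a direct consequence of sunniness that needs no
duality mapping).

The growth condition on `φ` turns total asymptotic nonexpansiveness into an affine bound: relative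
to a common fixed point `p`, the `n`-th iterates increase distances at most by a factor `1 + A n`
and a summand `B n`, both `A` and `B` being summable
(`IsTotalAsymptoticallyNonexpansive.norm_iterate_sub_le`). By the Tan–Xu lemma `‖x n - p‖` converges.
Schu's lemma, a form of uniform convexity for sequences, applied to each of the two convex
combinations of the scheme, then gives `x n - S (x n) → 0` and `x n - Q (x n) → 0`
(`IsTwoStepIteration.tendsto_norm_sub_retraction`).

Bounded sequences in a uniformly convex Banach space have weakly convergent subsequences. This is
proved without reflexivity: decreasing bounded closed convex sets have a common point because
almost minimal-norm points form a Cauchy sequence, and this is applied to the closed convex hulls of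
tails (`UniformConvexSpace.exists_subseq_weaklyConverges`). Every weak subsequential limit of `x` is
fixed by `S` and `Q`, by a demiclosedness principle combining Opial's condition with uniform
convexity (`IsTotalAsymptoticallyNonexpansive.retraction_fixed_of_weaklyConverges`). As the distances
of `x n` to all common fixed points converge, Opial's condition leaves room for a single weak
subsequential limit, so that the whole sequence converges weakly.
-/

/-! ### Uniform convexity -/

section UniformConvexity

variable {E : Type*} [NormedAddCommGroup E] [NormedSpace ℝ E] [UniformConvexSpace E]

/-- Uniform convexity near the sphere of radius `c`: the points may lie slightly outside the ball,
and the modulus `δ` is still uniform. -/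
theorem UniformConvexSpace.exists_norm_add_le (c : ℝ) {ε : ℝ} (hε : 0 < ε) :
    ∃ δ, 0 < δ ∧ ∀ x y : E, ‖x‖ ≤ c + δ → ‖y‖ ≤ c + δ → ε ≤ ‖x - y‖ →
      ‖x + y‖ ≤ 2 * c - δ := by
  rcases lt_or_ge c 0 with hc | hc
  · refine ⟨-c / 2, by linarith, fun x y hx _ _ => ?_⟩
    linarith [norm_nonneg x]
  obtain ⟨δ₀, hδ₀, h⟩ :=
    exists_forall_closed_ball_dist_add_le_two_mul_sub E (half_pos hε) c
  set δ := min (ε / 4) (δ₀ / 3) with hδdef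
  have hδ : 0 < δ := by positivity
  have hδ1 : δ ≤ ε / 4 := min_le_left _ _
  have hδ2 : δ ≤ δ₀ / 3 := min_le_right _ _
  refine ⟨δ, hδ, fun x y hx hy hxy => ?_⟩
  have hcδ : 0 < c + δ := by linarith
  -- Shrink both points into the ball of radius `c`; this moves each of them by at most `δ`.
  have shrink : ∀ z : E, ‖z‖ ≤ c + δ →
      ‖(c / (c + δ)) • z‖ ≤ c ∧ ‖z - (c / (c + δ)) • z‖ ≤ δ := by
    intro z hz
    constructor
    · rw [norm_smul, Real.norm_of_nonneg (by positivity), div_mul_eq_mul_div, div_le_iff₀ hcδ]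
      exact mul_le_mul_of_nonneg_left hz hc
    · have : z - (c / (c + δ)) • z = (δ / (c + δ)) • z := by
        nth_rewrite 1 [← one_smul ℝ z]
        rw [← sub_smul]
        congr 1
        field_simp
        ring
      rw [this, norm_smul, Real.norm_of_nonneg (by positivity), div_mul_eq_mul_div,
        div_le_iff₀ hcδ]
      exact mul_le_mul_of_nonneg_left hz hδ.le
  obtain ⟨hx1, hx2⟩ := shrink x hx
  obtain ⟨hy1, hy2⟩ := shrink y hy
  set x' := (c / (c + δ)) • x
  set y' := (c / (c + δ)) • y
  have hsep : ε / 2 ≤ ‖x' - y'‖ := by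
    have : x - y = (x' - y') + ((x - x') - (y - y')) := by abel
    have h1 : ‖x - y‖ ≤ ‖x' - y'‖ + (‖x - x'‖ + ‖y - y'‖) := by
      rw [this]
      exact (norm_add_le _ _).trans (add_le_add_right (norm_sub_le _ _) _)
    linarith
  have h2 := h hx1 hy1 hsep
  have : x + y = (x' + y') + ((x - x') + (y - y')) := by abel
  have h3 : ‖x + y‖ ≤ ‖x' + y'‖ + (‖x - x'‖ + ‖y - y'‖) := by
    rw [this]
    exact (norm_add_le _ _).trans (add_le_add_right (norm_add_le _ _) _)
  linarith

/-- The version for convex combinations whose weights stay away from `0` and `1`. -/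
theorem UniformConvexSpace.exists_norm_combo_le (c : ℝ) {e ε : ℝ} (he : 0 < e) (hε : 0 < ε) :
    ∃ δ, 0 < δ ∧ ∀ x y : E, ‖x‖ ≤ c + δ → ‖y‖ ≤ c + δ → ε ≤ ‖x - y‖ →
      ∀ t ∈ Set.Icc e (1 - e), ‖(1 - t) • x + t • y‖ ≤ c - δ := by
  obtain ⟨δ₀, hδ₀, h⟩ := exists_norm_add_le (E := E) c hε
  set δ := min δ₀ (e * δ₀ / 2) with hδdef
  have hδ : 0 < δ := by positivity
  have hδ1 : δ ≤ δ₀ := min_le_left _ _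
  have hδ2 : δ ≤ e * δ₀ / 2 := min_le_right _ _
  -- For `t ≤ 1/2` the combination is a convex combination of `x` and the midpoint.
  have key : ∀ x y : E, ‖x‖ ≤ c + δ → ‖y‖ ≤ c + δ → ε ≤ ‖x - y‖ →
      ∀ t, e ≤ t → t ≤ 1 / 2 → ‖(1 - t) • x + t • y‖ ≤ c - δ := by
    intro x y hx hy hxy t ht1 ht2
    have h1 := h x y (by linarith) (by linarith) hxy
    have h2 : (1 - t) • x + t • y = (1 - 2 * t) • x + t • (x + y) := by module
    have h3 : ‖(1 - t) • x + t • y‖ ≤ (1 - 2 * t) * ‖x‖ + t * ‖x + y‖ := by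
      rw [h2]
      refine (norm_add_le _ _).trans (le_of_eq ?_)
      rw [norm_smul, norm_smul, Real.norm_of_nonneg (by linarith : 0 ≤ 1 - 2 * t),
        Real.norm_of_nonneg (by linarith : 0 ≤ t)]
    have h4 : (1 - 2 * t) * ‖x‖ ≤ (1 - 2 * t) * (c + δ) :=
      mul_le_mul_of_nonneg_left hx (by linarith)
    have h5 : t * ‖x + y‖ ≤ t * (2 * c - δ₀) := mul_le_mul_of_nonneg_left h1 (by linarith)
    have h6 : e * δ₀ ≤ t * δ₀ := mul_le_mul_of_nonneg_right ht1 hδ₀.le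
    have h7 : 0 ≤ t * δ := mul_nonneg (by linarith) hδ.le
    nlinarith
  refine ⟨δ, hδ, fun x y hx hy hxy t ht => ?_⟩
  rcases le_total t (1 / 2) with h2 | h2
  · exact key x y hx hy hxy t ht.1 h2
  · have := key y x hy hx (by rwa [norm_sub_rev]) (1 - t) (by linarith [ht.2]) (by linarith)
    rwa [sub_sub_cancel, add_comm] at this

/-- **Schu's lemma**. The hypotheses on `u` and `v` say that the upper limits of the norms are at
most `c`. -/
theorem UniformConvexSpace.tendsto_norm_sub_zero {u v : ℕ → E} {t : ℕ → ℝ} {c e : ℝ} (he : 0 < e)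
    (ht : ∀ᶠ n in atTop, t n ∈ Set.Icc e (1 - e))
    (hu : ∀ η > 0, ∀ᶠ n in atTop, ‖u n‖ < c + η)
    (hv : ∀ η > 0, ∀ᶠ n in atTop, ‖v n‖ < c + η)
    (huv : Tendsto (fun n => ‖(1 - t n) • u n + t n • v n‖) atTop (𝓝 c)) :
    Tendsto (fun n => ‖u n - v n‖) atTop (𝓝 0) := by
  rw [Metric.tendsto_nhds]
  intro ε hε
  obtain ⟨δ, hδ, h⟩ := exists_norm_combo_le (E := E) c he hε
  filter_upwards [ht, hu δ hδ, hv δ hδ, huv.eventually (lt_mem_nhds (sub_lt_self c hδ))]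
    with n h1 h2 h3 h4
  rw [Real.dist_eq, sub_zero, abs_norm]
  by_contra! h5
  exact absurd (h _ _ h2.le h3.le h5 _ h1) (not_le.2 h4)

/-- In a uniformly convex Banach space, a decreasing sequence of nonempty closed convex sets, one
of which is bounded, has a common point: almost minimal-norm points form a Cauchy sequence. -/
theorem UniformConvexSpace.nonempty_iInter_of_antitone [CompleteSpace E] {C : ℕ → Set E}
    (hanti : Antitone C) (hne : ∀ n, (C n).Nonempty) (hcl : ∀ n, IsClosed (C n))
    (hconv : ∀ n, Convex ℝ (C n)) {R : ℝ} (hR : ∀ n, ∀ z ∈ C n, ‖z‖ ≤ R) :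
    (⋂ n, C n).Nonempty := by
  set d : ℕ → ℝ := fun n => Metric.infDist 0 (C n) with hd
  have hdle : ∀ n, ∀ z ∈ C n, d n ≤ ‖z‖ := fun n z hz => by
    simpa using Metric.infDist_le_dist_of_mem (x := (0 : E)) hz
  have hmono : Monotone d := fun m n hmn => Metric.infDist_le_infDist_of_subset (hanti hmn) (hne n)
  have hbdd : BddAbove (Set.range d) := by
    refine ⟨R, ?_⟩
    rintro _ ⟨n, rfl⟩
    obtain ⟨z, hz⟩ := hne n
    exact (hdle n z hz).trans (hR n z hz)
  have hlim := tendsto_atTop_ciSup hmono hbdd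
  set D := ⨆ n, d n
  have hdD : ∀ n, d n ≤ D := fun n => le_ciSup hbdd n
  have hz : ∀ n, ∃ z ∈ C n, ‖z‖ < d n + 1 / ((n : ℝ) + 1) := by
    intro n
    obtain ⟨z, hz, h⟩ := (Metric.infDist_lt_iff (x := (0 : E)) (hne n)).1
      (lt_add_of_pos_right (d n) (Nat.one_div_pos_of_nat (n := n)))
    exact ⟨z, hz, by simpa using h⟩
  choose z hzC hznorm using hz
  have hcauchy : CauchySeq z := by
    rw [Metric.cauchySeq_iff]
    intro ε hε
    obtain ⟨δ, hδ, h⟩ := exists_norm_add_le (E := E) D hε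
    have e1 : ∀ᶠ n in atTop, D - δ / 2 < d n :=
      hlim.eventually (lt_mem_nhds (by linarith))
    have e2 : ∀ᶠ n : ℕ in atTop, 1 / ((n : ℝ) + 1) < δ :=
      tendsto_one_div_add_atTop_nhds_zero_nat.eventually (gt_mem_nhds hδ)
    obtain ⟨N, hN⟩ := eventually_atTop.1 (e1.and e2)
    refine ⟨N, fun m hm n hn => ?_⟩
    by_contra! hfar
    rw [dist_eq_norm] at hfar
    have hle : ∀ k, N ≤ k → ‖z k‖ ≤ D + δ := fun k hk => by
      linarith [hznorm k, hdD k, (hN k hk).2]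
    have h1 := h _ _ (hle m hm) (hle n hn) hfar
    have hmid : (1 / 2 : ℝ) • z m + (1 / 2 : ℝ) • z n ∈ C N :=
      hconv N (hanti hm (hzC m)) (hanti hn (hzC n)) (by norm_num) (by norm_num) (by norm_num)
    have h2 := hdle N _ hmid
    rw [← smul_add, norm_smul, Real.norm_of_nonneg (by norm_num)] at h2
    linarith [(hN N le_rfl).1]
  obtain ⟨w, hw⟩ := cauchySeq_tendsto_of_complete hcauchy
  refine ⟨w, Set.mem_iInter.2 fun n => (hcl n).mem_of_tendsto hw ?_⟩
  filter_upwards [eventually_ge_atTop n] with m hm using hanti hm (hzC m)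

end UniformConvexity

/-! ### Weak convergence of subsequences -/

section WeakCompactness

variable {E : Type*} [NormedAddCommGroup E] [NormedSpace ℝ E]

theorem weaklyConverges_iff {u : ℕ → E} {a : E} :
    WeaklyConverges u a ↔ ∀ f : StrongDual ℝ E, Tendsto (fun n => f (u n)) atTop (𝓝 (f a)) := by
  have hinj : Function.Injective ((topDualPairing ℝ E).flip) := by
    intro x y hxy
    by_contra hne
    obtain ⟨f, -, hf⟩ := exists_dual_vector ℝ (x - y)
      (by rw [ne_eq, norm_eq_zero]; exact sub_ne_zero.2 hne)
    have : f x = f y := LinearMap.congr_fun hxy f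
    rw [map_sub, this, sub_self] at hf
    exact (norm_ne_zero_iff.2 (sub_ne_zero.2 hne)) (by simpa using hf.symm)
  exact WeakBilin.tendsto_iff_forall_eval_tendsto _ hinj

/-- Countably many functionals separate the points of a separable subspace: take functionals
norming the points of a dense sequence. -/
theorem exists_seq_dual_separating {V : Set E} (hV : TopologicalSpace.IsSeparable V) :
    ∃ f : ℕ → StrongDual ℝ E, ∀ w ∈ V, (∀ j, f j w = 0) → w = 0 := by
  obtain ⟨D, hDc, hD⟩ := hV
  rcases D.eq_empty_or_nonempty with rfl | hne
  · exact ⟨fun _ => 0, fun w hw => absurd (hD hw) (by simp)⟩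
  obtain ⟨d, rfl⟩ := hDc.exists_eq_range hne
  choose f hf1 hf2 using fun j => exists_dual_vector'' ℝ (d j)
  refine ⟨f, fun w hw h0 => ?_⟩
  by_contra hw0
  have hpos : 0 < ‖w‖ := norm_pos_iff.2 hw0
  obtain ⟨_, ⟨j, rfl⟩, hj⟩ := Metric.mem_closure_iff.1 (hD hw) (‖w‖ / 2) (by linarith)
  rw [dist_eq_norm] at hj
  have h1 : ‖d j‖ ≤ ‖w - d j‖ := by
    have h2 : f j (d j - w) = ‖d j‖ := by rw [map_sub, h0, sub_zero]; exact hf2 j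
    calc ‖d j‖ = ‖f j (d j - w)‖ := by rw [h2]; simp
      _ ≤ ‖f j‖ * ‖d j - w‖ := (f j).le_opNorm _
      _ ≤ 1 * ‖d j - w‖ := mul_le_mul_of_nonneg_right (hf1 j) (norm_nonneg _)
      _ = ‖w - d j‖ := by rw [one_mul, norm_sub_rev]
  have h3 : ‖w‖ ≤ ‖w - d j‖ + ‖d j‖ := by simpa using norm_add_le (w - d j) (d j)
  linarith

/-- A functional converging along a sequence takes its limit at every point lying in the closed
convex hulls of all tails. -/
theorem eq_of_mem_closedConvexHull_tails {u : ℕ → E} {z : E} {f : StrongDual ℝ E} {c : ℝ}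
    (hz : ∀ n, z ∈ closedConvexHull ℝ (u '' Set.Ici n))
    (hf : Tendsto (fun n => f (u n)) atTop (𝓝 c)) : f z = c := by
  refine eq_of_forall_dist_le fun ε hε => ?_
  obtain ⟨N, hN⟩ := (Metric.tendsto_atTop.1 hf) ε hε
  have hsub : closedConvexHull ℝ (u '' Set.Ici N) ⊆ f ⁻¹' Metric.closedBall c ε := by
    refine closedConvexHull_min ?_ ?_ (Metric.isClosed_closedBall.preimage f.continuous)
    · rintro _ ⟨n, hn, rfl⟩
      exact (hN n hn).le
    · exact (convex_closedBall c ε).linear_preimage (f : E →ₗ[ℝ] ℝ)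
  exact hsub (hz N)

/-- Weak sequential compactness in a uniformly convex Banach space. After a diagonal extraction
countably many functionals separating the closed span converge along the sequence; the closed convex
hulls of the tails of any further subsequence then meet in one and the same point, which is the weak
limit. -/
theorem UniformConvexSpace.exists_subseq_weaklyConverges [CompleteSpace E] [UniformConvexSpace E]
    {K : Set E} (hKcl : IsClosed K) (hKconv : Convex ℝ K) {u : ℕ → E} (huK : ∀ n, u n ∈ K)
    {R : ℝ} (hR : ∀ n, ‖u n‖ ≤ R) :
    ∃ a ∈ K, ∃ ψ : ℕ → ℕ, StrictMono ψ ∧ WeaklyConverges (u ∘ ψ) a := by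
  set V : Submodule ℝ E := (Submodule.span ℝ (Set.range u)).topologicalClosure with hVdef
  have hVcl : IsClosed (V : Set E) := Submodule.isClosed_topologicalClosure _
  have huV : ∀ n, u n ∈ V := fun n =>
    Submodule.le_topologicalClosure _ (Submodule.subset_span ⟨n, rfl⟩)
  have hVsep : TopologicalSpace.IsSeparable (V : Set E) := by
    rw [hVdef, Submodule.topologicalClosure_coe]
    exact ((Set.countable_range u).isSeparable.span (R := ℝ)).closure
  obtain ⟨f, hf⟩ := exists_seq_dual_separating hVsep
  have hR0 : 0 ≤ R := (norm_nonneg _).trans (hR 0)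
  have hbound : ∀ (g : StrongDual ℝ E) n, ‖g (u n)‖ ≤ ‖g‖ * R := fun g n =>
    (g.le_opNorm _).trans (mul_le_mul_of_nonneg_left (hR n) (norm_nonneg _))
  obtain ⟨L, -, ψ, hψ, hL⟩ := (isCompact_univ_pi
      (fun j => isCompact_closedBall (0 : ℝ) (‖f j‖ * R))).tendsto_subseq
    (x := fun n j => f j (u n)) (fun n j _ => by simpa using hbound (f j) n)
  rw [tendsto_pi_nhds] at hL
  have tails : ∀ χ : ℕ → ℕ, ∃ z ∈ K, z ∈ V ∧
      ∀ n, z ∈ closedConvexHull ℝ ((u ∘ χ) '' Set.Ici n) := by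
    intro χ
    have hsub : ∀ {S : Set E}, IsClosed S → Convex ℝ S → (∀ n, u n ∈ S) → ∀ n,
        closedConvexHull ℝ ((u ∘ χ) '' Set.Ici n) ⊆ S := fun hcl hcv hS n =>
      closedConvexHull_min (by rintro _ ⟨k, -, rfl⟩; exact hS _) hcv hcl
    obtain ⟨z, hz⟩ := UniformConvexSpace.nonempty_iInter_of_antitone
      (C := fun n => closedConvexHull ℝ ((u ∘ χ) '' Set.Ici n)) (R := R)
      (fun m n hmn => (closedConvexHull ℝ).monotone
        (Set.image_mono (Set.Ici_subset_Ici.2 hmn)))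
      (fun n => ⟨_, subset_closedConvexHull ⟨n, Set.mem_Ici.2 le_rfl, rfl⟩⟩)
      (fun n => isClosed_closedConvexHull) (fun n => convex_closedConvexHull)
      (fun n z hz => by
        simpa using hsub Metric.isClosed_closedBall (convex_closedBall (0 : E) R)
          (fun n => by simpa using hR n) n hz)
    rw [Set.mem_iInter] at hz
    exact ⟨z, hsub hKcl hKconv huK 0 (hz 0), hsub hVcl V.convex huV 0 (hz 0), hz⟩
  obtain ⟨a, haK, haV, ha⟩ := tails ψ
  have hfa : ∀ j, f j a = L j := fun j => eq_of_mem_closedConvexHull_tails ha (hL j)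
  refine ⟨a, haK, ψ, hψ, weaklyConverges_iff.2 fun g => ?_⟩
  refine tendsto_of_subseq_tendsto fun ns hns => ?_
  obtain ⟨c, -, ms, hms, hc⟩ := (isCompact_closedBall (0 : ℝ) (‖g‖ * R)).tendsto_subseq
    (x := fun n => g (u (ψ (ns n)))) (fun n => by simpa using hbound g _)
  refine ⟨ms, ?_⟩
  obtain ⟨b, -, hbV, hb⟩ := tails (ψ ∘ ns ∘ ms)
  have hfb : ∀ j, f j b = L j := fun j => eq_of_mem_closedConvexHull_tails hb
    ((hL j).comp (hns.comp hms.tendsto_atTop))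
  have hba : b = a := sub_eq_zero.1 <| hf _ (V.sub_mem hbV haV) fun j => by
    rw [map_sub, hfa, hfb, sub_self]
  have hgb : g b = c := eq_of_mem_closedConvexHull_tails hb hc
  rw [← hba, hgb]
  exact hc

end WeakCompactness

/-! ### Real sequences -/

/-- **Tan–Xu lemma**: a nonnegative sequence which is decreasing up to summable relative and
absolute errors converges. -/
theorem exists_tendsto_of_le_one_add_mul_add {r a b : ℕ → ℝ} (hr : ∀ n, 0 ≤ r n)
    (ha : ∀ n, 0 ≤ a n) (hb : ∀ n, 0 ≤ b n) (hsa : Summable a) (hsb : Summable b)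
    (h : ∀ n, r (n + 1) ≤ (1 + a n) * r n + b n) : ∃ c, Tendsto r atTop (𝓝 c) := by
  have hgrow : ∀ n, r n ≤
      Real.exp (∑ k ∈ Finset.range n, a k) * (r 0 + ∑ k ∈ Finset.range n, b k) := by
    intro n
    induction n with
    | zero => simp
    | succ n ih =>
      have h0 : 0 ≤ ∑ k ∈ Finset.range n, a k := Finset.sum_nonneg fun k _ => ha k
      have h1 : 1 ≤ Real.exp (∑ k ∈ Finset.range n, a k + a n) :=
        Real.one_le_exp (add_nonneg h0 (ha n))
      have h2 : 1 + a n ≤ Real.exp (a n) := by linarith [Real.add_one_le_exp (a n)]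
      rw [Finset.sum_range_succ, Finset.sum_range_succ]
      calc r (n + 1) ≤ (1 + a n) * r n + b n := h n
        _ ≤ Real.exp (a n) * (Real.exp (∑ k ∈ Finset.range n, a k) *
              (r 0 + ∑ k ∈ Finset.range n, b k)) + b n := by
            gcongr
            exact hr n
        _ = Real.exp (∑ k ∈ Finset.range n, a k + a n) *
              (r 0 + ∑ k ∈ Finset.range n, b k) + 1 * b n := by
            rw [Real.exp_add]; ring
        _ ≤ Real.exp (∑ k ∈ Finset.range n, a k + a n) *
              (r 0 + ∑ k ∈ Finset.range n, b k) +
              Real.exp (∑ k ∈ Finset.range n, a k + a n) * b n := by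
            gcongr
            exact hb n
        _ = _ := by ring
  set C := Real.exp (∑' k, a k) * (r 0 + ∑' k, b k) with hC
  have hrC : ∀ n, r n ≤ C := fun n => (hgrow n).trans <| by
    have h1 := hsa.sum_le_tsum (Finset.range n) fun k _ => ha k
    have h2 := hsb.sum_le_tsum (Finset.range n) fun k _ => hb k
    have h3 : 0 ≤ ∑ k ∈ Finset.range n, b k := Finset.sum_nonneg fun k _ => hb k
    exact mul_le_mul (Real.exp_le_exp.2 h1) (by linarith) (add_nonneg (hr 0) h3)
      (Real.exp_pos _).le
  have hC0 : 0 ≤ C := (hr 0).trans (hrC 0)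
  set e : ℕ → ℝ := fun n => a n * C + b n
  have he0 : ∀ n, 0 ≤ e n := fun n => add_nonneg (mul_nonneg (ha n) hC0) (hb n)
  have hse : Summable e := (hsa.mul_right C).add hsb
  have hanti : Antitone fun n => r n - ∑ k ∈ Finset.range n, e k := by
    refine antitone_nat_of_succ_le fun n => ?_
    rw [Finset.sum_range_succ]
    have := h n
    have h1 := mul_le_mul_of_nonneg_left (hrC n) (ha n)
    simp only [e]
    linarith
  have hbdd : BddBelow (Set.range fun n => r n - ∑ k ∈ Finset.range n, e k) := by
    refine ⟨-∑' k, e k, ?_⟩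
    rintro _ ⟨n, rfl⟩
    have := hse.sum_le_tsum (Finset.range n) fun k _ => he0 k
    simp only
    linarith [hr n]
  refine ⟨_, ((tendsto_atTop_ciInf hanti hbdd).add hse.hasSum.tendsto_sum_nat).congr fun n => ?_⟩
  simp

theorem eventually_lt_add_of_eventually_le {w b : ℕ → ℝ} {c : ℝ} (hwb : ∀ᶠ n in atTop, w n ≤ b n)
    (hb : Tendsto b atTop (𝓝 c)) : ∀ η > 0, ∀ᶠ n in atTop, w n < c + η := fun η hη => by
  filter_upwards [hwb, hb.eventually (gt_mem_nhds (lt_add_of_pos_right c hη))] with n h1 h2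
  exact h1.trans_lt h2

/-! ### Fixed points of a nonself map and of its retracted self map -/

section FixedPoints

variable {E : Type*} [NormedAddCommGroup E] [NormedSpace ℝ E] {K : Set E} {P : E → K} {T : K → E}

theorem IsSunnyNonexpansiveRetraction.apply_of_fixed (hP : IsSunnyNonexpansiveRetraction P) {a : K}
    (ha : T a = (a : E)) : P (T a) = a := by
  rw [ha]; exact hP.retraction a

/-- For a weakly inward `T` the maps `T` and `P ∘ T` have the same fixed points. If `P (T a) = a`,
sunniness sends the whole ray from `a` through `T a` to `a`, so that no direction `w` pointing from
`a` into `K` is shortened by subtracting a nonnegative multiple of `v = T a - a`. Weak inwardness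
makes `v` itself a limit of such directions, and subtracting `v` from `v` leaves `0`. -/
theorem IsWeaklyInward.fixed_of_retraction_fixed (hP : IsSunnyNonexpansiveRetraction P)
    (hT : IsWeaklyInward T) {a : K} (ha : P (T a) = a) : T a = (a : E) := by
  set v := T a - (a : E) with hv
  have hray : ∀ t : ℝ, 0 ≤ t → P ((a : E) + t • v) = a := by
    intro t ht
    have := hP.sunny (T a) t ht
    rwa [ha] at this
  have hdir : ∀ z ∈ inwardSet K (a : E), ‖z - a‖ ≤ ‖z - a - v‖ := by
    rintro _ ⟨u, hu, c, hc, rfl⟩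
    have hc0 : 0 < c := by linarith
    have h1 := hP.nonexpansive u ((a : E) + c⁻¹ • v)
    rw [hray _ (inv_nonneg.2 hc0.le), hP.retraction ⟨u, hu⟩] at h1
    have h2 := mul_le_mul_of_nonneg_left h1 hc0.le
    have e1 : (a : E) + c • (u - a) - a = c • (u - a) := by abel
    have e2 : c • (u - (a : E)) - v = c • (u - ((a : E) + c⁻¹ • v)) := by
      rw [smul_sub, smul_sub, smul_add, smul_smul, mul_inv_cancel₀ hc0.ne', one_smul]; abel
    rw [e1, e2, norm_smul, norm_smul, Real.norm_of_nonneg hc0.le]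
    exact h2
  have hcl : IsClosed {z : E | ‖z - a‖ ≤ ‖z - a - v‖} :=
    isClosed_le (by fun_prop) (by fun_prop)
  have h : ‖T a - (a : E)‖ ≤ ‖T a - (a : E) - v‖ :=
    closure_minimal (fun z hz => hdir z hz) hcl (hT a)
  rw [← hv, sub_self, norm_zero, norm_le_zero_iff] at h
  exact sub_eq_zero.1 h

/-- The distances to a common fixed point grow at most affinely under the `n`-th iterate: linear
growth of `φ` beyond `M` and monotonicity below `M` bound the gauge by `φ M + Mstar * κ`. -/
theorem IsTotalAsymptoticallyNonexpansive.norm_iterate_sub_le {μ lam : ℕ → ℝ} {φ : ℝ → ℝ}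
    (hT : IsTotalAsymptoticallyNonexpansive P T μ lam φ) {M Mstar : ℝ} (hM : 0 < M)
    (hMstar : 0 < Mstar) (hφ : ∀ κ, M ≤ κ → φ κ ≤ Mstar * κ) {p : K} (hp : P (T p) = p)
    {n : ℕ} (hn : 1 ≤ n) (z : K) :
    ‖(((P ∘ T)^[n] z : K) : E) - p‖
      ≤ (1 + Mstar * μ n) * ‖(z : E) - p‖ + (φ M * μ n + lam n) := by
  have hfix : (P ∘ T)^[n] p = p := Function.iterate_fixed hp n
  have h1 := hT.bound n hn z p
  rw [hfix] at h1
  have hφM : 0 < φ M := hT.phi_zero ▸ hT.phi_strictMono hM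
  have h2 : φ ‖(z : E) - p‖ ≤ φ M + Mstar * ‖(z : E) - p‖ := by
    rcases le_total M ‖(z : E) - p‖ with h | h
    · linarith [hφ _ h]
    · have := hT.phi_strictMono.monotone h
      have : 0 ≤ Mstar * ‖(z : E) - p‖ := by positivity
      linarith
  have h3 := mul_le_mul_of_nonneg_left h2 (hT.mu_nonneg n hn)
  linarith

theorem IsUniformlyLipschitzian.norm_sub_le {L : ℝ} (hLip : IsUniformlyLipschitzian P T L)
    (z w : K) : ‖(((P ∘ T) z : K) : E) - (((P ∘ T) w : K) : E)‖ ≤ L * ‖(z : E) - w‖ := by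
  simpa using hLip 1 le_rfl z w

/-- **Demiclosedness principle** for `I - P ∘ T`. By Opial's condition the weak limit `a` minimizes
`b ↦ limsup ‖u n - b‖`; the iterates `(P ∘ T)^[m] a` are asymptotically as good as `a`, so that
uniform convexity, applied to midpoints, forces them to converge to `a`. -/
theorem IsTotalAsymptoticallyNonexpansive.retraction_fixed_of_weaklyConverges [UniformConvexSpace E]
    (hOpial : OpialCondition E) {μ lam : ℕ → ℝ} {φ : ℝ → ℝ}
    (hT : IsTotalAsymptoticallyNonexpansive P T μ lam φ)
    {L : ℝ} (hLip : IsUniformlyLipschitzian P T L) {u : ℕ → K} {a : K} {R : ℝ}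
    (hR : ∀ n, ‖(u n : E)‖ ≤ R) (hua : WeaklyConverges (fun n => (u n : E)) a)
    (hu : Tendsto (fun n => ‖(u n : E) - P (T (u n))‖) atTop (𝓝 0)) : P (T a) = a := by
  have hbdd : ∀ b : E, ∀ n, ‖(u n : E) - b‖ ≤ R + ‖b‖ := fun b n =>
    (norm_sub_le _ _).trans (add_le_add_left (hR n) _)
  have hbu : ∀ b : E, IsBoundedUnder (· ≤ ·) atTop fun n => ‖(u n : E) - b‖ := fun b =>
    isBoundedUnder_of ⟨_, hbdd b⟩
  have hcob : ∀ b : E, IsCoboundedUnder (· ≤ ·) atTop fun n => ‖(u n : E) - b‖ := fun b =>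
    (isBoundedUnder_of (r := (· ≥ ·)) ⟨0, fun n => norm_nonneg _⟩).isCoboundedUnder_le
  set r := limsup (fun n => ‖(u n : E) - a‖) atTop with hr
  have hmin : ∀ b : E, r ≤ limsup (fun n => ‖(u n : E) - b‖) atTop := by
    intro b
    rcases eq_or_ne b a with rfl | hb
    · exact le_rfl
    · exact (hOpial _ _ _ hua hb).le
  -- For each fixed `m`, the sequence `u` is also asymptotically fixed by the `m`-th iterate.
  have hiter : ∀ m, Tendsto (fun n => ‖(u n : E) - (P ∘ T)^[m] (u n)‖) atTop (𝓝 0) := by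
    intro m
    induction m with
    | zero => simp
    | succ m ih =>
      have hsum := hu.add (ih.const_mul L)
      rw [mul_zero, add_zero] at hsum
      refine squeeze_zero (fun n => norm_nonneg _) (fun n => ?_) hsum
      rw [Function.iterate_succ_apply']
      have h1 := hLip.norm_sub_le (u n) ((P ∘ T)^[m] (u n))
      have h2 := norm_sub_le_norm_sub_add_norm_sub (u n : E) (P (T (u n)))
        ((P ∘ T) ((P ∘ T)^[m] (u n)))
      exact h2.trans (add_le_add_right h1 _)
  have hconv : Tendsto (fun m => ‖(a : E) - (P ∘ T)^[m] a‖) atTop (𝓝 0) := by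
    rw [Metric.tendsto_nhds]
    intro ε hε
    obtain ⟨δ, hδ, hδuc⟩ := UniformConvexSpace.exists_norm_add_le (E := E) r hε
    have herr : Tendsto (fun m => μ m * φ (r + δ / 4) + lam m) atTop (𝓝 0) := by
      simpa using (hT.mu_tendsto.mul_const (φ (r + δ / 4))).add hT.lam_tendsto
    filter_upwards [herr.eventually (gt_mem_nhds (by linarith : (0 : ℝ) < δ / 4)),
      eventually_ge_atTop 1] with m hm hm1
    rw [Real.dist_eq, sub_zero, abs_norm]
    by_contra! hfar
    set b : E := (1 / 2 : ℝ) • ((a : E) + (P ∘ T)^[m] a) with hb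
    -- The midpoint `b` would beat the minimal value `r`.
    have hev : ∀ᶠ n in atTop, ‖(u n : E) - b‖ ≤ r - δ / 2 := by
      filter_upwards [eventually_lt_of_limsup_lt (show r < r + δ / 4 by linarith) (hbu a),
        (hiter m).eventually (gt_mem_nhds (by linarith : (0 : ℝ) < δ / 4))] with n h1 h2
      have h3 := hT.bound m hm1 (u n) a
      have h4 := mul_le_mul_of_nonneg_left (hT.phi_strictMono.monotone h1.le)
        (hT.mu_nonneg m hm1)
      have h5 := norm_sub_le_norm_sub_add_norm_sub (u n : E) ((P ∘ T)^[m] (u n))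
        ((P ∘ T)^[m] a)
      have h6 := hδuc ((u n : E) - a) ((u n : E) - (P ∘ T)^[m] a) (by linarith) (by linarith)
        (by rwa [sub_sub_sub_cancel_left, norm_sub_rev])
      have h7 : (u n : E) - b =
          (1 / 2 : ℝ) • (((u n : E) - a) + ((u n : E) - (P ∘ T)^[m] a)) := by
        rw [hb]; module
      rw [h7, norm_smul, Real.norm_of_nonneg (by norm_num)]
      linarith
    have := limsup_le_of_le (hcob b) hev
    linarith [hmin b]
  have hlim : Tendsto (fun m => ‖(a : E) - (P ∘ T)^[m + 1] a‖ + L * ‖(a : E) - (P ∘ T)^[m] a‖)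
      atTop (𝓝 0) := by
    simpa using ((tendsto_add_atTop_iff_nat 1).2 hconv).add (hconv.const_mul L)
  have hle : ‖(a : E) - P (T a)‖ ≤ 0 := by
    refine ge_of_tendsto' hlim fun m => ?_
    have h1 := hLip.norm_sub_le a ((P ∘ T)^[m] a)
    rw [← Function.iterate_succ_apply' (P ∘ T)] at h1
    have h2 := norm_sub_le_norm_sub_add_norm_sub (a : E) ((P ∘ T)^[m + 1] a) (P (T a))
    rw [norm_sub_rev (((P ∘ T)^[m + 1] a : K) : E)] at h2
    exact h2.trans (add_le_add_right h1 _)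
  exact (Subtype.ext (sub_eq_zero.1 (norm_le_zero_iff.1 hle))).symm

end FixedPoints

/-! ### The two-step iteration -/

section Iteration

variable {E : Type*} [NormedAddCommGroup E] [NormedSpace ℝ E] {K : Set E} {P : E → K}

/-- A sequence with vanishing steps which is asymptotically fixed by the running iterates
`(P ∘ T)^[n]` is asymptotically fixed by `P ∘ T`. -/
theorem IsUniformlyLipschitzian.tendsto_norm_sub_retraction {T : K → E} {L : ℝ} (hL : 0 ≤ L)
    (hLip : IsUniformlyLipschitzian P T L) {x : ℕ → K}
    (hx : Tendsto (fun n => ‖(x n : E) - (P ∘ T)^[n] (x n)‖) atTop (𝓝 0))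
    (hstep : Tendsto (fun n => ‖(x (n + 1) : E) - x n‖) atTop (𝓝 0)) :
    Tendsto (fun n => ‖(x n : E) - P (T (x n))‖) atTop (𝓝 0) := by
  rw [← tendsto_add_atTop_iff_nat 1]
  have hx1 := (tendsto_add_atTop_iff_nat 1).2 hx
  have hlim : Tendsto (fun n => ‖(x (n + 1) : E) - (P ∘ T)^[n + 1] (x (n + 1))‖ +
      L * (‖(x (n + 1) : E) - x n‖ + ‖(x n : E) - (P ∘ T)^[n] (x n)‖ +
        L * ‖(x (n + 1) : E) - x n‖)) atTop (𝓝 0) := by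
    simpa using hx1.add (((hstep.add hx).add (hstep.const_mul L)).const_mul L)
  refine squeeze_zero' (Eventually.of_forall fun n => norm_nonneg _) ?_ hlim
  filter_upwards [eventually_ge_atTop 1] with n hn
  have h1 := norm_sub_le_norm_sub_add_norm_sub (x (n + 1) : E) ((P ∘ T)^[n + 1] (x (n + 1)))
    (P (T (x (n + 1))))
  have h2 := hLip.norm_sub_le (x (n + 1)) ((P ∘ T)^[n] (x (n + 1)))
  rw [← Function.iterate_succ_apply' (P ∘ T), norm_sub_rev] at h2
  have h3 := norm_sub_le_norm_sub_add_norm_sub (x (n + 1) : E) (x n) ((P ∘ T)^[n] (x (n + 1)))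
  have h4 := norm_sub_le_norm_sub_add_norm_sub (x n : E) ((P ∘ T)^[n] (x n))
    ((P ∘ T)^[n] (x (n + 1)))
  have h5 := hLip n hn (x n) (x (n + 1))
  rw [norm_sub_rev (x n : E)] at h5
  have h6 := mul_le_mul_of_nonneg_left (h3.trans (add_le_add_right (h4.trans
    (add_le_add_right h5 _)) _)) hL
  rw [← add_assoc] at h6
  exact h1.trans (add_le_add_right (h2.trans h6) _)

theorem norm_combo_sub_le {t : ℝ} (h0 : 0 ≤ t) (h1 : t ≤ 1) {a b p : E} {C : ℝ}
    (ha : ‖a - p‖ ≤ C) (hb : ‖b - p‖ ≤ C) : ‖(1 - t) • a + t • b - p‖ ≤ C := by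
  rw [← dist_eq_norm] at *
  exact (convex_closedBall p C) ha hb (sub_nonneg.2 h1) h0 (by ring)

variable {T₁ T₂ : K → E} {α β : ℕ → ℝ} {x y : ℕ → K}

/-- If the `n`-th iterates of both maps increase the distance to `p` at most by the factor `1 + A n`
and the summand `B n`, summably, then the distances of the two-step iteration to `p` converge. -/
theorem IsTwoStepIteration.exists_tendsto_norm_sub (hxy : IsTwoStepIteration P T₁ T₂ α β x y)
    (hα : ∀ n, 1 ≤ n → α n ∈ Set.Icc (0 : ℝ) 1) (hβ : ∀ n, 1 ≤ n → β n ∈ Set.Icc (0 : ℝ) 1)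
    {p : E} {A B : ℕ → ℝ} (hA : ∀ n, 1 ≤ n → 0 ≤ A n) (hB : ∀ n, 1 ≤ n → 0 ≤ B n)
    (hsA : Summable A) (hsB : Summable B)
    (h₁ : ∀ n, 1 ≤ n → ∀ z : K, ‖((P ∘ T₁)^[n] z : E) - p‖ ≤ (1 + A n) * ‖(z : E) - p‖ + B n)
    (h₂ : ∀ n, 1 ≤ n → ∀ z : K, ‖((P ∘ T₂)^[n] z : E) - p‖ ≤ (1 + A n) * ‖(z : E) - p‖ + B n) :
    (∃ c, Tendsto (fun n => ‖(x n : E) - p‖) atTop (𝓝 c)) ∧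
      ∀ n, 1 ≤ n → ‖(y n : E) - p‖ ≤ (1 + A n) * ‖(x n : E) - p‖ + B n := by
  have hy : ∀ n, 1 ≤ n → ‖(y n : E) - p‖ ≤ (1 + A n) * ‖(x n : E) - p‖ + B n := by
    intro n hn
    rw [hxy.y_eq n hn]
    refine norm_combo_sub_le (hβ n hn).1 (hβ n hn).2 ?_ (h₁ n hn _)
    have := mul_nonneg (hA n hn) (norm_nonneg ((x n : E) - p))
    linarith [hB n hn]
  refine ⟨?_, hy⟩
  obtain ⟨C, hC⟩ := hsA.tendsto_atTop_zero.bddAbove_range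
  have hAC : ∀ n, A n ≤ C := fun n => hC ⟨n, rfl⟩
  have hC0 : 0 ≤ C := (hA 1 le_rfl).trans (hAC 1)
  have hrec : ∀ n, 1 ≤ n → ‖(x (n + 1) : E) - p‖ ≤
      (1 + (2 + C) * A n) * ‖(x n : E) - p‖ + (2 + C) * B n := by
    intro n hn
    have hyn := mul_le_mul_of_nonneg_left (hy n hn) (show 0 ≤ 1 + A n by linarith [hA n hn])
    have h3 : ‖(x (n + 1) : E) - p‖ ≤ (1 + A n) * ‖(y n : E) - p‖ + B n := by
      rw [hxy.x_succ n hn]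
      exact norm_combo_sub_le (hα n hn).1 (hα n hn).2 (h₁ n hn _) (h₂ n hn _)
    have h4 : A n * A n * ‖(x n : E) - p‖ ≤ C * A n * ‖(x n : E) - p‖ :=
      mul_le_mul_of_nonneg_right (mul_le_mul_of_nonneg_right (hAC n) (hA n hn)) (norm_nonneg _)
    have h5 : A n * B n ≤ C * B n := mul_le_mul_of_nonneg_right (hAC n) (hB n hn)
    linarith
  obtain ⟨c, hc⟩ := exists_tendsto_of_le_one_add_mul_add
    (r := fun n => ‖(x (n + 1) : E) - p‖) (a := fun n => (2 + C) * A (n + 1))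
    (b := fun n => (2 + C) * B (n + 1)) (fun n => norm_nonneg _)
    (fun n => mul_nonneg (by linarith) (hA _ (Nat.le_add_left 1 n)))
    (fun n => mul_nonneg (by linarith) (hB _ (Nat.le_add_left 1 n)))
    (((summable_nat_add_iff 1).2 hsA).mul_left _) (((summable_nat_add_iff 1).2 hsB).mul_left _)
    (fun n => hrec _ (Nat.le_add_left 1 n))
  exact ⟨c, (tendsto_add_atTop_iff_nat 1).1 hc⟩

/-- The iteration is asymptotically fixed by both retracted maps. Schu's lemma, applied to the
second step, shows that `(P ∘ T₁)^[n] (y n)` and `(P ∘ T₂)^[n] (y n)` approach each other; hence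
`‖y n - p‖` has the same limit as `‖x n - p‖`, and Schu's lemma applies to the first step. -/
theorem IsTwoStepIteration.tendsto_norm_sub_retraction [UniformConvexSpace E]
    (hxy : IsTwoStepIteration P T₁ T₂ α β x y) {ε : ℝ} (hε : 0 < ε)
    (hα : ∀ n, 1 ≤ n → α n ∈ Set.Icc ε (1 - ε)) (hβ : ∀ n, 1 ≤ n → β n ∈ Set.Icc ε (1 - ε))
    {L : ℝ} (hL : 0 ≤ L) (hLip₁ : IsUniformlyLipschitzian P T₁ L)
    (hLip₂ : IsUniformlyLipschitzian P T₂ L)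
    {p : E} {A B : ℕ → ℝ} (hA : ∀ n, 1 ≤ n → 0 ≤ A n) (hB : ∀ n, 1 ≤ n → 0 ≤ B n)
    (hsA : Summable A) (hsB : Summable B)
    (h₁ : ∀ n, 1 ≤ n → ∀ z : K, ‖((P ∘ T₁)^[n] z : E) - p‖ ≤ (1 + A n) * ‖(z : E) - p‖ + B n)
    (h₂ : ∀ n, 1 ≤ n → ∀ z : K, ‖((P ∘ T₂)^[n] z : E) - p‖ ≤ (1 + A n) * ‖(z : E) - p‖ + B n) :
    Tendsto (fun n => ‖(x n : E) - P (T₁ (x n))‖) atTop (𝓝 0) ∧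
      Tendsto (fun n => ‖(x n : E) - P (T₂ (x n))‖) atTop (𝓝 0) := by
  have unit : ∀ {t : ℝ}, t ∈ Set.Icc ε (1 - ε) → t ∈ Set.Icc (0 : ℝ) 1 := fun ht =>
    ⟨hε.le.trans ht.1, ht.2.trans (by linarith)⟩
  obtain ⟨⟨c, hc⟩, hy⟩ := hxy.exists_tendsto_norm_sub (fun n hn => unit (hα n hn))
    (fun n hn => unit (hβ n hn)) hA hB hsA hsB h₁ h₂
  have hA0 := hsA.tendsto_atTop_zero
  have hB0 := hsB.tendsto_atTop_zero
  have hge := eventually_ge_atTop 1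
  set S : ℕ → K → E := fun n z => (P ∘ T₁)^[n] z with hS
  set Q : ℕ → K → E := fun n z => (P ∘ T₂)^[n] z with hQ
  -- The affine error disappears in the limit, so upper bounds tending to `c` are preserved.
  have hub : ∀ {w : ℕ → ℝ}, Tendsto w atTop (𝓝 c) →
      Tendsto (fun n => (1 + A n) * w n + B n) atTop (𝓝 c) := fun hw => by
    simpa using ((hA0.const_add 1).mul hw).add hB0
  have hybd := hub hc
  have himage : ∀ {F : ℕ → K → E},
      (∀ n, 1 ≤ n → ∀ z : K, ‖F n z - p‖ ≤ (1 + A n) * ‖(z : E) - p‖ + B n) →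
      ∀ η > 0, ∀ᶠ n in atTop, ‖F n (y n) - p‖ < c + η := fun hF =>
    eventually_lt_add_of_eventually_le (by
      filter_upwards [hge] with n hn
      refine (hF n hn (y n)).trans ?_
      have := mul_le_mul_of_nonneg_left (hy n hn) (show 0 ≤ 1 + A n by linarith [hA n hn])
      exact add_le_add_left this _) (hub hybd)
  have hSQ : Tendsto (fun n => ‖S n (y n) - Q n (y n)‖) atTop (𝓝 0) := by
    have hlim : Tendsto (fun n => ‖(1 - α n) • (S n (y n) - p) + α n • (Q n (y n) - p)‖)
        atTop (𝓝 c) := by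
      refine ((tendsto_add_atTop_iff_nat 1).2 hc).congr' ?_
      filter_upwards [hge] with n hn
      rw [hxy.x_succ n hn]
      congr 1
      module
    have := UniformConvexSpace.tendsto_norm_sub_zero hε
      (by filter_upwards [hge] with n hn using hα n hn) (himage h₁) (himage h₂) hlim
    simpa using this
  have hxS : Tendsto (fun n => ‖(x (n + 1) : E) - S n (y n)‖) atTop (𝓝 0) := by
    refine squeeze_zero' (Eventually.of_forall fun n => norm_nonneg _) ?_ hSQ
    filter_upwards [hge] with n hn
    have h : (x (n + 1) : E) - S n (y n) = α n • (Q n (y n) - S n (y n)) := by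
      rw [hxy.x_succ n hn]; module
    rw [h, norm_smul, norm_sub_rev, Real.norm_of_nonneg (unit (hα n hn)).1]
    exact mul_le_of_le_one_left (norm_nonneg _) (unit (hα n hn)).2
  have hyc : Tendsto (fun n => ‖(y n : E) - p‖) atTop (𝓝 c) := by
    have hlow : Tendsto (fun n => ‖(x (n + 1) : E) - p‖ - ‖(x (n + 1) : E) - S n (y n)‖ -
        A n * ((1 + A n) * ‖(x n : E) - p‖ + B n) - B n) atTop (𝓝 c) := by
      simpa using ((((tendsto_add_atTop_iff_nat 1).2 hc).sub hxS).sub (hA0.mul hybd)).sub hB0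
    refine tendsto_of_tendsto_of_tendsto_of_le_of_le' hlow hybd ?_ ?_
    · filter_upwards [hge] with n hn
      have e1 := h₁ n hn (y n)
      have e2 := norm_sub_le_norm_sub_add_norm_sub (x (n + 1) : E) (S n (y n)) p
      have e3 := mul_le_mul_of_nonneg_left (hy n hn) (hA n hn)
      simp only [hS] at e2 ⊢
      linarith
    · filter_upwards [hge] with n hn using hy n hn
  have hxSx : Tendsto (fun n => ‖(x n : E) - S n (x n)‖) atTop (𝓝 0) := by
    have hlim : Tendsto (fun n => ‖(1 - β n) • ((x n : E) - p) + β n • (S n (x n) - p)‖)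
        atTop (𝓝 c) := by
      refine hyc.congr' ?_
      filter_upwards [hge] with n hn
      rw [hxy.y_eq n hn]
      congr 1
      module
    have := UniformConvexSpace.tendsto_norm_sub_zero hε
      (by filter_upwards [hge] with n hn using hβ n hn)
      (eventually_lt_add_of_eventually_le (Eventually.of_forall fun n => le_rfl) hc)
      (eventually_lt_add_of_eventually_le
        (by filter_upwards [hge] with n hn using h₁ n hn (x n)) hybd) hlim
    simpa using this
  have hxyn : Tendsto (fun n => ‖(y n : E) - x n‖) atTop (𝓝 0) := by
    refine squeeze_zero' (Eventually.of_forall fun n => norm_nonneg _) ?_ hxSx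
    filter_upwards [hge] with n hn
    have h : (y n : E) - x n = β n • (S n (x n) - x n) := by
      rw [hxy.y_eq n hn]; module
    rw [h, norm_smul, norm_sub_rev, Real.norm_of_nonneg (unit (hβ n hn)).1]
    exact mul_le_of_le_one_left (norm_nonneg _) (unit (hβ n hn)).2
  have hxSy : Tendsto (fun n => ‖(x n : E) - S n (y n)‖) atTop (𝓝 0) := by
    refine squeeze_zero' (Eventually.of_forall fun n => norm_nonneg _) ?_
      (by simpa using hxSx.add (hxyn.const_mul L))
    filter_upwards [hge] with n hn
    have e1 := hLip₁ n hn (x n) (y n)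
    rw [norm_sub_rev (x n : E)] at e1
    exact (norm_sub_le_norm_sub_add_norm_sub _ (S n (x n)) _).trans (add_le_add_right e1 _)
  have hstep : Tendsto (fun n => ‖(x (n + 1) : E) - x n‖) atTop (𝓝 0) := by
    refine squeeze_zero (fun n => norm_nonneg _) (fun n => ?_) (by simpa using hxS.add hxSy)
    have e1 := norm_sub_le_norm_sub_add_norm_sub (x (n + 1) : E) (S n (y n)) (x n)
    rwa [norm_sub_rev (S n (y n))] at e1
  have hxQx : Tendsto (fun n => ‖(x n : E) - Q n (x n)‖) atTop (𝓝 0) := by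
    refine squeeze_zero' (Eventually.of_forall fun n => norm_nonneg _) ?_
      (by simpa using (hxSy.add hSQ).add (hxyn.const_mul L))
    filter_upwards [hge] with n hn
    have e1 := hLip₂ n hn (y n) (x n)
    have e2 := norm_sub_le_norm_sub_add_norm_sub (x n : E) (S n (y n)) (Q n (y n))
    exact (norm_sub_le_norm_sub_add_norm_sub _ (Q n (y n)) _).trans (add_le_add e2 e1)
  exact ⟨hLip₁.tendsto_norm_sub_retraction hL hxSx hstep,
    hLip₂.tendsto_norm_sub_retraction hL hxQx hstep⟩

end Iteration

/-! ### Weak convergence -/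

section WeakConvergence

variable {E : Type*} [NormedAddCommGroup E] [NormedSpace ℝ E]

/-- Under Opial's condition, a sequence has at most one weak subsequential limit among the points to
which its distances converge. -/
theorem OpialCondition.eq_of_tendsto_norm_sub (hOpial : OpialCondition E) {u : ℕ → E} {a b : E}
    {ψ χ : ℕ → ℕ} (hψ : Tendsto ψ atTop atTop) (hχ : Tendsto χ atTop atTop)
    (ha : WeaklyConverges (u ∘ ψ) a) (hb : WeaklyConverges (u ∘ χ) b)
    (hla : ∃ c, Tendsto (fun n => ‖u n - a‖) atTop (𝓝 c))
    (hlb : ∃ c, Tendsto (fun n => ‖u n - b‖) atTop (𝓝 c)) : a = b := by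
  obtain ⟨ca, hca⟩ := hla
  obtain ⟨cb, hcb⟩ := hlb
  by_contra hne
  have h1 := hOpial _ a b ha (Ne.symm hne)
  have h2 := hOpial _ b a hb hne
  have e1 := (hca.comp hψ).limsup_eq
  have e2 := (hcb.comp hψ).limsup_eq
  have e3 := (hca.comp hχ).limsup_eq
  have e4 := (hcb.comp hχ).limsup_eq
  simp only [Function.comp_def] at h1 h2 e1 e2 e3 e4
  linarith

/-- In a uniformly convex Banach space with Opial's condition, a bounded sequence in a closed convex
set `K` converges weakly to a point of `F` as soon as all its weak subsequential limits in `K` lie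
in `F` and its distances to each point of `F` converge. -/
theorem OpialCondition.exists_weaklyConverges [CompleteSpace E] [UniformConvexSpace E]
    (hOpial : OpialCondition E) {K F : Set E} (hKcl : IsClosed K) (hKconv : Convex ℝ K)
    {u : ℕ → E} (huK : ∀ n, u n ∈ K) {R : ℝ} (hR : ∀ n, ‖u n‖ ≤ R)
    (hF : ∀ ψ : ℕ → ℕ, Tendsto ψ atTop atTop → ∀ a ∈ K, WeaklyConverges (u ∘ ψ) a → a ∈ F)
    (hdist : ∀ a ∈ F, ∃ c, Tendsto (fun n => ‖u n - a‖) atTop (𝓝 c)) :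
    ∃ a ∈ F, WeaklyConverges u a := by
  obtain ⟨a, haK, ψ, hψ, ha⟩ :=
    UniformConvexSpace.exists_subseq_weaklyConverges hKcl hKconv huK hR
  have haF := hF ψ hψ.tendsto_atTop a haK ha
  refine ⟨a, haF, weaklyConverges_iff.2 fun g => tendsto_of_subseq_tendsto fun ns hns => ?_⟩
  obtain ⟨b, hbK, ms, hms, hb⟩ := UniformConvexSpace.exists_subseq_weaklyConverges hKcl hKconv
    (u := u ∘ ns) (fun n => huK _) (fun n => hR _)
  have hχ : Tendsto (ns ∘ ms) atTop atTop := hns.comp hms.tendsto_atTop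
  have hbF := hF _ hχ b hbK hb
  have hab := hOpial.eq_of_tendsto_norm_sub hψ.tendsto_atTop hχ ha hb (hdist a haF) (hdist b hbF)
  exact ⟨ms, hab ▸ weaklyConverges_iff.1 hb g⟩

end WeakConvergence

theorem mainTheorem4 {E : Type*} [NormedAddCommGroup E] [NormedSpace ℝ E] [CompleteSpace E]
    [UniformConvexSpace E] (hsmooth : IsSmoothSpace E) (hOpial : OpialCondition E)
    {K : Set E} (hKne : K.Nonempty) (hKcl : IsClosed K) (hKconv : Convex ℝ K)
    (P : E → K) (hP : IsSunnyNonexpansiveRetraction P)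
    (T₁ T₂ : K → E) (hin₁ : IsWeaklyInward T₁) (hin₂ : IsWeaklyInward T₂)
    (L : ℝ) (hL : 0 ≤ L)
    (hLip₁ : IsUniformlyLipschitzian P T₁ L) (hLip₂ : IsUniformlyLipschitzian P T₂ L)
    (μ lam : ℕ → ℝ) (φ : ℝ → ℝ)
    (hT₁ : IsTotalAsymptoticallyNonexpansive P T₁ μ lam φ)
    (hT₂ : IsTotalAsymptoticallyNonexpansive P T₂ μ lam φ)
    (hμ : Summable μ) (hlam : Summable lam)
    (M Mstar : ℝ) (hM : 0 < M) (hMstar : 0 < Mstar) (hφ : ∀ κ, M ≤ κ → φ κ ≤ Mstar * κ)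
    (ε : ℝ) (hε : ε ∈ Set.Ioo (0 : ℝ) 1) (α β : ℕ → ℝ)
    (hα : ∀ n, 1 ≤ n → α n ∈ Set.Icc ε (1 - ε)) (hβ : ∀ n, 1 ≤ n → β n ∈ Set.Icc ε (1 - ε))
    (hF : ∃ p : K, T₁ p = (p : E) ∧ T₂ p = (p : E))
    (hdemi₁ : IsDemiclosedAt (fun z : K => (z : E) - T₁ z) 0)
    (hdemi₂ : IsDemiclosedAt (fun z : K => (z : E) - T₂ z) 0)
    (x y : ℕ → K) (hxy : IsTwoStepIteration P T₁ T₂ α β x y) :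
    ∃ p : K, T₁ p = (p : E) ∧ T₂ p = (p : E) ∧ WeaklyConverges (fun n => (x n : E)) (p : E) := by
  have hε0 := hε.1
  have unit : ∀ {t : ℝ}, t ∈ Set.Icc ε (1 - ε) → t ∈ Set.Icc (0 : ℝ) 1 := fun ht =>
    ⟨hε0.le.trans ht.1, ht.2.trans (by linarith)⟩
  have hφM : 0 < φ M := hT₁.phi_zero ▸ hT₁.phi_strictMono hM
  have hA : ∀ n, 1 ≤ n → 0 ≤ Mstar * μ n := fun n hn =>
    mul_nonneg hMstar.le (hT₁.mu_nonneg n hn)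
  have hB : ∀ n, 1 ≤ n → 0 ≤ φ M * μ n + lam n := fun n hn =>
    add_nonneg (mul_nonneg hφM.le (hT₁.mu_nonneg n hn)) (hT₁.lam_nonneg n hn)
  have hsA : Summable fun n => Mstar * μ n := hμ.mul_left _
  have hsB : Summable fun n => φ M * μ n + lam n := (hμ.mul_left _).add hlam
  have bound₁ := fun (p : K) (hp : P (T₁ p) = p) (n : ℕ) (hn : 1 ≤ n) =>
    hT₁.norm_iterate_sub_le hM hMstar hφ hp hn
  have bound₂ := fun (p : K) (hp : P (T₂ p) = p) (n : ℕ) (hn : 1 ≤ n) =>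
    hT₂.norm_iterate_sub_le hM hMstar hφ hp hn
  have hdist : ∀ p : K, P (T₁ p) = p → P (T₂ p) = p →
      ∃ c, Tendsto (fun n => ‖(x n : E) - p‖) atTop (𝓝 c) := fun p hp₁ hp₂ =>
    (hxy.exists_tendsto_norm_sub (fun n hn => unit (hα n hn)) (fun n hn => unit (hβ n hn)) hA hB
      hsA hsB (bound₁ p hp₁) (bound₂ p hp₂)).1
  obtain ⟨p, hp₁, hp₂⟩ := hF
  have hp₁' := hP.apply_of_fixed hp₁
  have hp₂' := hP.apply_of_fixed hp₂
  obtain ⟨hx₁, hx₂⟩ := hxy.tendsto_norm_sub_retraction hε0 hα hβ hL hLip₁ hLip₂ hA hB hsA hsB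
    (bound₁ p hp₁') (bound₂ p hp₂')
  obtain ⟨c, hc⟩ := hdist p hp₁' hp₂'
  obtain ⟨C, hC⟩ := hc.bddAbove_range
  have hR : ∀ n, ‖(x n : E)‖ ≤ C + ‖(p : E)‖ := fun n => by
    have h1 : ‖(x n : E) - p‖ ≤ C := hC ⟨n, rfl⟩
    have h2 := norm_sub_norm_le (x n : E) p
    linarith
  obtain ⟨_, ⟨q, hq₁, hq₂, rfl⟩, hq⟩ := hOpial.exists_weaklyConverges
    (F := {z | ∃ q : K, P (T₁ q) = q ∧ P (T₂ q) = q ∧ (q : E) = z}) hKcl hKconv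
    (fun n => (x n).2) hR
    (fun ψ hψ a haK ha => ⟨⟨a, haK⟩,
      hT₁.retraction_fixed_of_weaklyConverges hOpial hLip₁ (u := x ∘ ψ) (a := ⟨a, haK⟩)
        (fun n => hR _) ha (hx₁.comp hψ),
      hT₂.retraction_fixed_of_weaklyConverges hOpial hLip₂ (u := x ∘ ψ) (a := ⟨a, haK⟩)
        (fun n => hR _) ha (hx₂.comp hψ), rfl⟩)
    (by rintro _ ⟨q, hq₁, hq₂, rfl⟩; exact hdist q hq₁ hq₂)
  exact ⟨q, hin₁.fixed_of_retraction_fixed hP hq₁, hin₂.fixed_of_retraction_fixed hP hq₂, hq⟩
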